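/- Let $\mathfrak V$ be a variety of algebras (the class of all algebras of a given finitary signature satisfying a given set of identities), let $\mathcal F\in\mathfrak V$ be a free $\mathfrak V$-algebra of infinite rank $\varkappa$ with basis $\mathcal B$ (so $|\mathcal B|=\varkappa$), and let $\lambda<\varkappa$ be an infinite cardinal. For $\varphi\in\mathrm{Aut}(\mathcal F)$ put $\mathrm{supp}(\varphi)=\{b\in\mathcal B:\varphi b\neq b\}$, and let $$G=\mathrm{Aut}_{\lambda,\mathcal B}(\mathcal F)=\{\varphi\in\mathrm{Aut}(\mathcal F): |\mathrm{supp}(\varphi)|\le\lambda\},$$ a subgroup of $\mathrm{Aut}(\mathcal F)$. For a subset $S$ of a group $H$, the length of $h\in H$ with respect to $S$ is the least number of elements of $S\cup S^{-1}$ whose product is $h$, and the width of $H$ with respect to $S$ is the supremum of the lengths of the elements of $H$. The group $H$ is said to be of finite $C$-width if it has finite width with respect to every generating set that is invariant under conjugation by the elements of $H$. An automorphism of $\mathcal F$ is called permutational if it maps some basis of $\mathcal F$ onto itself. Then the following hold. (1) There are a set $\mathcal C_0\subseteq\mathcal B$ of cardinality $\lambda$ and an element $\pi^*\in G$ which fixes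 $\mathcal B\setminus\mathcal C_0$ pointwise and acts on $\mathcal C_0$ as an involution without fixed points. (2) For every $\mathcal C_0\subseteq\mathcal B$ of cardinality $\lambda$ and every such $\pi^*\in G$, the automorphism $\pi^*$ is permutational and of order $2$, and its conjugacy class $C(\pi^*)$ in $G$ generates $G$ in at most four steps: $G=\langle C(\pi^*)\rangle$, $G=C(\pi^*)^4$ (every element of $G$ is a product of four elements of $C(\pi^*)$), and the width of $G$ with respect to $C(\pi^*)$ is at most $4$. (3) $G$ is a group of finite $C$-width. -/

import Mathlib

open Cardinal FirstOrder
open scoped Pointwise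

universe u v w

/-! ### Width of a group -/

section Width

variable {G : Type*} [Group G]

/-- The length of `g` with respect to `S`: the least number of factors in an expression of `g` as
a product of elements of `S ∪ S⁻¹` (`⊤` if there is no such expression). -/
noncomputable def wordLength (S : Set G) (g : G) : ℕ∞ :=
  sInf {n : ℕ∞ | ∃ l : List G, (∀ x ∈ l, x ∈ S ∪ S⁻¹) ∧ l.prod = g ∧ (l.length : ℕ∞) = n}

/-- The width of `G` with respect to `S`: the supremum of the lengths of the elements of `G`. -/
noncomputable def groupWidth (S : Set G) : ℕ∞ := ⨆ g : G, wordLength S g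

/-- `S` is invariant under all inner automorphisms of `G`. -/
def ConjInvariant (S : Set G) : Prop := ∀ g : G, ∀ s ∈ S, g * s * g⁻¹ ∈ S

/-- `G` has finite width with respect to every conjugation-invariant generating set. -/
def FiniteCWidth (G : Type*) [Group G] : Prop :=
  ∀ S : Set G, Subgroup.closure S = ⊤ → ConjInvariant S → groupWidth S < ⊤

end Width

/-! ### Varieties of algebras and free algebras

An algebraic signature is a first-order language without relation symbols; a variety is the class
of all algebras of the signature that satisfy a given set of identities. -/

section Variety

variable {L : FirstOrder.Language.{u, v}}

/-- The algebra `A` satisfies all the identities in `E`, i.e. `A` lies in the variety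
defined by `E`. -/
def InVariety (E : Set (L.Term ℕ × L.Term ℕ)) (A : Type*) [L.Structure A] : Prop :=
  ∀ p ∈ E, ∀ x : ℕ → A, p.1.realize x = p.2.realize x

/-- `F` is a free algebra of the variety defined by `E`, and `B ⊆ F` is a basis of it: `F` lies in
the variety, and every map from `B` to an algebra of the variety extends uniquely to a homomorphism.
The universe of the test algebras is large enough to contain a copy of `F` and the quotients
of the term algebra over `B`. -/
structure IsFreeBasis (E : Set (L.Term ℕ × L.Term ℕ)) {F : Type w} [L.Structure F]
    (B : Set F) : Prop where
  inVariety : InVariety E F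
  existsUnique_hom : ∀ (A : Type (max u w)) [L.Structure A], InVariety E A →
    ∀ f : B → A, ∃! φ : F →[L] A, ∀ b : B, φ b = f b

/-- The automorphism group of an algebra, with composition as multiplication. -/
instance autGroup (F : Type w) [L.Structure F] : Group (F ≃[L] F) where
  mul f g := f.comp g
  one := FirstOrder.Language.Equiv.refl L F
  inv f := f.symm
  mul_assoc _ _ _ := rfl
  one_mul _ := rfl
  mul_one _ := rfl
  inv_mul_cancel f := FirstOrder.Language.Equiv.ext fun x => f.toEquiv.symm_apply_apply x

theorem aut_mul_apply {F : Type w} [L.Structure F] (f g : F ≃[L] F) (x : F) :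
    (f * g) x = f (g x) := rfl

theorem aut_one_apply {F : Type w} [L.Structure F] (x : F) :
    (1 : F ≃[L] F) x = x := rfl

theorem aut_inv_apply_self {F : Type w} [L.Structure F] (f : F ≃[L] F) (x : F) :
    f⁻¹ (f x) = x := f.toEquiv.symm_apply_apply x

/-- The support of an automorphism with respect to `B`. -/
def autSupport {F : Type w} [L.Structure F] (B : Set F) (φ : F ≃[L] F) : Set F :=
  {b | b ∈ B ∧ φ b ≠ b}

/-- The group of automorphisms whose support in `B` has at most `lam` elements, for an infinite
cardinal `lam`. -/
def boundedAut (L : FirstOrder.Language.{u, v}) {F : Type w} [L.Structure F] (B : Set F)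
    (lam : Cardinal.{w}) (hlam : ℵ₀ ≤ lam) : Subgroup (F ≃[L] F) where
  carrier := {φ | #(autSupport B φ) ≤ lam}
  one_mem' := by
    have h : autSupport B (1 : F ≃[L] F) = ∅ := by
      ext b
      simp [autSupport, aut_one_apply]
    simp [h]
  mul_mem' := by
    intro f g hf hg
    have h : autSupport B (f * g) ⊆ autSupport B f ∪ autSupport B g := by
      rintro b ⟨hb, hne⟩
      by_cases hgb : g b = b
      · refine Or.inl ⟨hb, fun hfb => hne ?_⟩
        rw [aut_mul_apply, hgb, hfb]
      · exact Or.inr ⟨hb, hgb⟩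
    exact (mk_le_mk_of_subset h).trans ((mk_union_le _ _).trans (add_le_of_le hlam hf hg))
  inv_mem' := by
    intro f hf
    have h : autSupport B f⁻¹ ⊆ autSupport B f := by
      rintro b ⟨hb, hne⟩
      refine ⟨hb, fun hfb => hne ?_⟩
      have := aut_inv_apply_self f b
      rwa [hfb] at this
    exact (mk_le_mk_of_subset h).trans hf

/-- An automorphism of a free algebra is permutational if it maps some basis of the algebra
onto itself. -/
def IsPermutational (E : Set (L.Term ℕ × L.Term ℕ)) {F : Type w} [L.Structure F]
    (φ : F ≃[L] F) : Prop :=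
  ∃ X : Set F, IsFreeBasis E X ∧ φ '' X = X

/-- `φ` fixes `B \ C` pointwise and acts on `C` as an involution without fixed points. -/
def IsFreeInvolutionOn {F : Type w} [L.Structure F] (B C : Set F) (φ : F ≃[L] F) : Prop :=
  (∀ b ∈ B \ C, φ b = b) ∧ ∀ c ∈ C, φ c ∈ C ∧ φ c ≠ c ∧ φ (φ c) = c

end Variety

/-!
Every `φ` in the group is supported on some `D ⊆ B` with `lam` elements: it fixes `B \ D`
pointwise and preserves the subalgebra generated by `D`. As `lam < #B`, some permutation `σ` of `B`
carries `D` to pairwise disjoint sets `D, σ D, σ² D, …`. Since `B` is a basis, the conjugates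
`σⁿ φ σ⁻ⁿ`, which act on these disjoint sets, assemble to one automorphism `α`. Conjugation by `σ`
deletes the first factor of this infinite product, so `φ = α (σ α⁻¹ σ⁻¹)` is a commutator of `α`
and `σ`. The permutation `σ` can be chosen as a shift of `D × ℤ`, hence as a product `ρ τ` of two
reflections, and then `φ = (α ρ α⁻¹) (α τ α⁻¹) τ ρ`. Each of these four involutions is conjugate
to `π*`, because involutions of `B` that move exactly `lam` points are conjugate.
-/

open scoped commutatorElement

section Width

variable {G : Type*} [Group G] {S T : Set G}

theorem ConjInvariant.inv (hS : ConjInvariant S) : ConjInvariant S⁻¹ := by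
  intro g s hs
  simpa [mul_assoc] using hS g s⁻¹ hs

theorem ConjInvariant.union (hS : ConjInvariant S) (hT : ConjInvariant T) :
    ConjInvariant (S ∪ T) :=
  fun g s hs => hs.imp (hS g s) (hT g s)

theorem ConjInvariant.mul (hS : ConjInvariant S) (hT : ConjInvariant T) :
    ConjInvariant (S * T) := by
  rintro g _ ⟨s, hs, t, ht, rfl⟩
  exact ⟨g * s * g⁻¹, hS g s hs, g * t * g⁻¹, hT g t ht, by group⟩

theorem ConjInvariant.pow (hS : ConjInvariant S) (n : ℕ) : ConjInvariant (S ^ n) := by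
  induction n with
  | zero => simp [ConjInvariant]
  | succ n ih => exact pow_succ S n ▸ ih.mul hS

theorem ConjInvariant.conjugatesOf_subset (hS : ConjInvariant S) {a : G} (ha : a ∈ S) :
    conjugatesOf a ⊆ S := by
  intro b hab
  obtain ⟨g, rfl⟩ := isConj_iff.1 hab
  exact hS g a ha

theorem wordLength_le_of_mem_pow {g : G} {n : ℕ} (hg : g ∈ (S ∪ S⁻¹) ^ n) :
    wordLength S g ≤ n := by
  obtain ⟨x, rfl⟩ := Set.mem_pow.1 hg
  exact sInf_le ⟨_, List.forall_mem_ofFn_iff.2 fun i => (x i).2, rfl, by simp⟩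

theorem groupWidth_le_of_union_inv_pow_eq_univ {n : ℕ} (h : (S ∪ S⁻¹) ^ n = Set.univ) :
    groupWidth S ≤ n :=
  iSup_le fun g => wordLength_le_of_mem_pow (h ▸ Set.mem_univ g)

theorem groupWidth_le_of_pow_eq_univ {n : ℕ} (h : S ^ n = Set.univ) : groupWidth S ≤ n :=
  groupWidth_le_of_union_inv_pow_eq_univ <|
    Set.univ_subset_iff.1 (h ▸ Set.pow_subset_pow_left Set.subset_union_left)

theorem closure_eq_top_of_pow_eq_univ {n : ℕ} (h : S ^ n = Set.univ) :
    Subgroup.closure S = ⊤ := by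
  rw [eq_top_iff, ← Subgroup.closure_univ, ← h]
  exact Subgroup.closure_pow_le

theorem exists_mem_union_inv_pow_of_mem_closure {g : G} (hg : g ∈ Subgroup.closure S) :
    ∃ n : ℕ, g ∈ (S ∪ S⁻¹) ^ n := by
  rw [← Subgroup.mem_toSubmonoid, Subgroup.closure_toSubmonoid] at hg
  obtain ⟨l, hl, rfl⟩ := Submonoid.exists_list_of_mem_closure hg
  refine ⟨l.length, Set.mem_pow.2 ⟨fun i => ⟨l.get i, hl _ (l.get_mem i)⟩, ?_⟩⟩
  rw [List.ofFn_get]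

theorem finiteCWidth_of_conjugatesOf_pow_eq_univ {a : G} {n : ℕ}
    (h : conjugatesOf a ^ n = Set.univ) : FiniteCWidth G := by
  intro S hgen hS
  obtain ⟨m, ha⟩ := exists_mem_union_inv_pow_of_mem_closure (hgen ▸ Subgroup.mem_top a)
  have hconj : conjugatesOf a ⊆ (S ∪ S⁻¹) ^ m := ((hS.union hS.inv).pow m).conjugatesOf_subset ha
  have huniv : (S ∪ S⁻¹) ^ (m * n) = Set.univ := by
    rw [pow_mul, ← Set.univ_subset_iff, ← h]
    exact Set.pow_subset_pow_left hconj
  exact (groupWidth_le_of_union_inv_pow_eq_univ huniv).trans_lt (ENat.natCast_lt_top _)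

theorem commutatorElement_mul_mem_conjugatesOf_pow_four {π ρ τ : G} (hπ : π⁻¹ = π)
    (hρ : IsConj π ρ) (hτ : IsConj π τ) (a : G) : ⁅a, ρ * τ⁆ ∈ conjugatesOf π ^ 4 := by
  have conj_mem {x : G} (hx : IsConj π x) : a * x * a⁻¹ ∈ conjugatesOf π :=
    hx.trans (isConj_iff.2 ⟨a, rfl⟩)
  have inv_mem {x : G} (hx : IsConj π x) : x⁻¹ ∈ conjugatesOf π := by
    obtain ⟨c, rfl⟩ := isConj_iff.1 hx
    exact isConj_iff.2 ⟨c, by rw [conj_inv, hπ]⟩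
  have expand : ⁅a, ρ * τ⁆ = a * ρ * a⁻¹ * (a * τ * a⁻¹) * τ⁻¹ * ρ⁻¹ := by
    rw [commutatorElement_def]
    group
  rw [expand, pow_succ, pow_succ, pow_two]
  exact Set.mul_mem_mul (Set.mul_mem_mul (Set.mul_mem_mul (conj_mem hρ) (conj_mem hτ))
    (inv_mem hτ)) (inv_mem hρ)

end Width

section Involutions

open Equiv Function

variable {α β : Type*}

theorem eq_viaEmbedding {r : Perm α} {m : α ↪ β} {p : Perm β} (h : ∀ a, p (m a) = m (r a))
    (hfix : ∀ b ∉ Set.range m, p b = b) : p = r.viaEmbedding m := by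
  ext b
  by_cases hb : b ∈ Set.range m
  · obtain ⟨a, rfl⟩ := hb
    rw [h, Perm.viaEmbedding_apply]
  · rw [hfix b hb, Perm.viaEmbedding_apply_of_notMem _ _ _ hb]

theorem conj_viaEmbedding (r : Perm α) (m : α ↪ β) (c : Perm β) :
    c * r.viaEmbedding m * c⁻¹ = r.viaEmbedding (m.trans c.toEmbedding) := by
  refine eq_viaEmbedding (fun a => by simp [Perm.viaEmbedding_apply]) fun b hb => ?_
  have hcb : c⁻¹ b ∉ Set.range m := fun ⟨a, ha⟩ => hb ⟨a, by simp [ha]⟩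
  rw [Perm.mul_apply, Perm.mul_apply, Perm.viaEmbedding_apply_of_notMem _ _ _ hcb,
    ← Perm.mul_apply, mul_inv_cancel, Perm.one_apply]

theorem setOf_viaEmbedding_ne (r : Perm α) (m : α ↪ β) :
    {b | r.viaEmbedding m b ≠ b} = m '' {a | r a ≠ a} := by
  ext b
  by_cases hb : b ∈ Set.range m
  · obtain ⟨a, rfl⟩ := hb
    simp [Perm.viaEmbedding_apply]
  · simpa [Perm.viaEmbedding_apply_of_notMem _ _ _ hb] using fun a _ ha => hb ⟨a, ha⟩

theorem involutive_viaEmbedding {r : Perm α} (hr : Involutive r) (m : α ↪ β) :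
    Involutive (r.viaEmbedding m) := by
  intro b
  by_cases hb : b ∈ Set.range m
  · obtain ⟨a, rfl⟩ := hb
    rw [Perm.viaEmbedding_apply, Perm.viaEmbedding_apply, hr]
  · rw [Perm.viaEmbedding_apply_of_notMem _ _ _ hb, Perm.viaEmbedding_apply_of_notMem _ _ _ hb]

theorem exists_transversal_of_involutive {r : Perm β} (hr : Involutive r) :
    ∃ H : Set β, Disjoint H (r '' H) ∧ H ∪ r '' H = {b | r b ≠ b} := by
  classical
  let _ : LinearOrder β := linearOrderOfSTO WellOrderingRel
  have himage : r '' {b | b < r b} = {b | r b < b} := by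
    ext b
    refine ⟨?_, fun hb => ⟨r b, by simpa [hr b] using hb, hr b⟩⟩
    rintro ⟨a, ha, rfl⟩
    simpa [hr a] using ha
  refine ⟨{b | b < r b}, ?_, ?_⟩
  · rw [himage]
    refine Set.disjoint_left.2 fun b hb hb' => ?_
    exact lt_asymm (Set.mem_ofPred.1 hb) (Set.mem_ofPred.1 hb')
  · rw [himage]
    ext b
    simp only [Set.mem_union, Set.mem_ofPred_eq, lt_or_lt_iff_ne, ne_comm]

end Involutions

section CardinalInvolutions

open Equiv Function

variable {α β : Type w}

theorem exists_sumComm_viaEmbedding_eq [Infinite α] {r : Perm β} (hr : Involutive r)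
    (hcard : #{b | r b ≠ b} = #α) :
    ∃ m : α ⊕ α ↪ β, Perm.viaEmbedding (Equiv.sumComm α α) m = r := by
  obtain ⟨H, hdisj, hunion⟩ := exists_transversal_of_involutive hr
  have hH : #H = #α := by
    have hadd : #H + #H = #α := by
      rw [← hcard, ← hunion, mk_union_of_disjoint hdisj, mk_image_eq r.injective]
    have hinf : ℵ₀ ≤ #H := or_self_iff.1 (aleph0_le_add_iff.1 (hadd ▸ aleph0_le_mk α))
    rw [← hadd, add_eq_self hinf]
  obtain ⟨g⟩ : Nonempty (α ≃ H) := Cardinal.eq.1 hH.symm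
  let g' : α ↪ β := g.toEmbedding.trans (Embedding.subtype _)
  have hrange : Set.range g' = H := (g.surjective.range_comp Subtype.val).trans Subtype.range_coe
  let m : α ⊕ α ↪ β := ⟨Sum.elim g' (r ∘ g'), g'.injective.sumElim (r.injective.comp g'.injective)
    fun a a' => Set.disjoint_iff_forall_ne.1 hdisj (g a).2 (Set.mem_image_of_mem r (g a').2)⟩
  refine ⟨m, (eq_viaEmbedding ?_ fun b hb => ?_).symm⟩
  · rintro (a | a)
    · rfl
    · exact hr (g' a)
  · have hb' : b ∉ H ∪ r '' H := by
      simpa [m, Set.Sum.elim_range, Set.range_comp, hrange] using hb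
    rw [hunion] at hb'
    exact not_not.1 hb'

theorem exists_perm_trans_eq_of_disjoint (m m' : α ↪ β)
    (hd : Disjoint (Set.range m) (Set.range m')) :
    ∃ c : Perm β, m.trans c.toEmbedding = m' ∧
      {b | c b ≠ b} ⊆ Set.range m ∪ Set.range m' := by
  let ι : α ⊕ α ↪ β := ⟨Sum.elim m m', m.injective.sumElim m'.injective fun a a' =>
    Set.disjoint_iff_forall_ne.1 hd ⟨a, rfl⟩ ⟨a', rfl⟩⟩
  refine ⟨Perm.viaEmbedding (Equiv.sumComm α α) ι, ?_, ?_⟩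
  · ext a
    exact Perm.viaEmbedding_apply (Equiv.sumComm α α) ι (Sum.inl a)
  · rw [setOf_viaEmbedding_ne, ← Set.Sum.elim_range]
    exact Set.image_subset_range _ _

theorem exists_perm_trans_eq [Infinite α] (hlt : #α < #β) (m m' : α ↪ β) :
    ∃ c : Perm β, m.trans c.toEmbedding = m' ∧ #{b | c b ≠ b} ≤ #α := by
  have union_le {X Y : Set β} (hX : #X ≤ #α) (hY : #Y ≤ #α) : #(X ∪ Y : Set β) ≤ #α :=
    (mk_union_le X Y).trans (add_le_of_le (aleph0_le_mk α) hX hY)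
  have range_le (k : α ↪ β) : #(Set.range k) ≤ #α := mk_range_le
  have hU := union_le (range_le m) (range_le m')
  have : Infinite β := infinite_iff.2 ((aleph0_le_mk α).trans hlt.le)
  -- The ranges of `m` and `m'` may overlap: pass through an embedding `k'` disjoint from both.
  obtain ⟨k⟩ : Nonempty (α ↪ ↥(Set.range m ∪ Set.range m')ᶜ) := by
    rw [← Cardinal.le_def, mk_compl_of_infinite _ (hU.trans_lt hlt)]
    exact hlt.le
  let k' : α ↪ β := k.trans (Embedding.subtype _)
  have hk : Disjoint (Set.range m ∪ Set.range m') (Set.range k') := by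
    rw [Set.disjoint_right]
    rintro _ ⟨a, rfl⟩
    exact (k a).2
  rw [Set.disjoint_union_left] at hk
  obtain ⟨c, hc, hcU⟩ := exists_perm_trans_eq_of_disjoint m k' hk.1
  obtain ⟨d, hd, hdU⟩ := exists_perm_trans_eq_of_disjoint k' m' hk.2.symm
  refine ⟨d * c, by rw [← hd, ← hc]; rfl, ?_⟩
  have hsub : {b | (d * c) b ≠ b} ⊆ {b | d b ≠ b} ∪ {b | c b ≠ b} := by
    intro b hb
    by_contra! h
    simp only [Set.mem_union, Set.mem_ofPred_eq, not_or, not_not] at h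
    exact hb (by rw [Perm.mul_apply, h.2, h.1])
  exact (mk_le_mk_of_subset hsub).trans (union_le
    ((mk_le_mk_of_subset hdU).trans (union_le (range_le k') (range_le m')))
    ((mk_le_mk_of_subset hcU).trans (union_le (range_le m) (range_le k'))))

theorem exists_conj_eq_of_involutive {r p : Perm β} (hr : Involutive r) (hp : Involutive p)
    (hinf : ℵ₀ ≤ #{b | r b ≠ b}) (hlt : #{b | r b ≠ b} < #β)
    (hcard : #{b | p b ≠ b} = #{b | r b ≠ b}) :
    ∃ c : Perm β, #{b | c b ≠ b} ≤ #{b | r b ≠ b} ∧ c * r * c⁻¹ = p := by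
  let α : Type w := ↥{b | r b ≠ b}
  have : Infinite α := infinite_iff.2 hinf
  have hsum : #(α ⊕ α) = #α := by rw [mk_sum, lift_id, add_eq_self hinf]
  obtain ⟨m, hm⟩ := exists_sumComm_viaEmbedding_eq (α := α) hr rfl
  obtain ⟨m', hm'⟩ := exists_sumComm_viaEmbedding_eq (α := α) hp hcard
  obtain ⟨c, hc, hcard_c⟩ := exists_perm_trans_eq (hsum ▸ hlt) m m'
  exact ⟨c, hsum ▸ hcard_c, by rw [← hm, ← hm', conj_viaEmbedding, hc]⟩

theorem mk_prod_int [Infinite α] : #(α × ℤ) = #α := by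
  rw [mk_prod, lift_id', mk_int, lift_aleph0]
  exact mul_eq_left (aleph0_le_mk α) (aleph0_le_mk α) aleph0_ne_zero

/-- The reflection `i ↦ k - i` of the second coordinate of `X × ℤ`. The product of the reflections
for `k = 0` and `k = -1` is the shift by one. -/
def reflectInt (X : Type*) (k : ℤ) : Perm (X × ℤ) :=
  (Equiv.refl X).prodCongr (Equiv.subLeft k)

theorem reflectInt_apply {X : Type*} (k : ℤ) (x : X) (i : ℤ) :
    reflectInt X k (x, i) = (x, k - i) := rfl

theorem involutive_reflectInt (X : Type*) (k : ℤ) : Involutive (reflectInt X k) :=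
  fun ⟨x, i⟩ => by simp [reflectInt_apply]

theorem mk_setOf_reflectInt_ne [Infinite α] (k : ℤ) : #{x | reflectInt α k x ≠ x} = #α := by
  refine le_antisymm ((mk_set_le _).trans mk_prod_int.le) ?_
  obtain ⟨i, hi⟩ : ∃ i : ℤ, k - i ≠ i := ⟨k.natAbs + 1, by omega⟩
  have moved (a : α) : reflectInt α k (a, i) ≠ (a, i) := fun h => hi (congrArg Prod.snd h)
  exact mk_le_of_injective (f := fun a => (⟨_, moved a⟩ : {x | reflectInt α k x ≠ x}))
    fun a a' h => congrArg (Prod.fst ∘ Subtype.val) h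

theorem exists_prodInt_embedding (D : Set β) [Infinite D] (hlt : #D < #β) :
    ∃ e : D × ℤ ↪ β, ∀ d : D, e (d, 0) = d := by
  have : Infinite β := infinite_iff.2 ((aleph0_le_mk D).trans hlt.le)
  obtain ⟨k⟩ : Nonempty (D × ℤ ↪ ↥Dᶜ) := by
    rw [← Cardinal.le_def, mk_prod_int, mk_compl_of_infinite D hlt]
    exact hlt.le
  let f : D × ℤ → β := fun x => if x.2 = 0 then x.1 else k x
  suffices hf : Injective f from ⟨⟨f, hf⟩, fun d => by simp [f]⟩
  rintro ⟨d, i⟩ ⟨d', i'⟩ h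
  simp only [f] at h
  split_ifs at h with hi hi' hi'
  · exact Prod.ext (Subtype.ext h) (hi.trans hi'.symm)
  · exact absurd d.2 (h ▸ (k (d', i')).2)
  · exact absurd d'.2 (h ▸ (k (d, i)).2)
  · exact k.injective (Subtype.ext h)

theorem exists_involutive_pairwise_disjoint_pow_image (D : Set β) [Infinite D]
    (hlt : #D < #β) :
    ∃ ρ τ : Perm β, (Involutive ρ ∧ #{b | ρ b ≠ b} = #D) ∧
      (Involutive τ ∧ #{b | τ b ≠ b} = #D) ∧
      Pairwise (Disjoint on fun n : ℕ => ⇑((ρ * τ) ^ n) '' D) := by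
  obtain ⟨e, he⟩ := exists_prodInt_embedding D hlt
  let s (k : ℤ) : Perm β := (reflectInt D k).viaEmbedding e
  have hs (k : ℤ) : Involutive (s k) ∧ #{b | s k b ≠ b} = #D := by
    refine ⟨involutive_viaEmbedding (involutive_reflectInt D k) e, ?_⟩
    rw [setOf_viaEmbedding_ne, mk_image_eq e.injective, mk_setOf_reflectInt_ne]
  have shift (d : D) (i : ℤ) : (s 0 * s (-1)) (e (d, i)) = e (d, i + 1) := by
    simp only [s, Perm.mul_apply, Perm.viaEmbedding_apply, reflectInt_apply]
    congr 2
    ring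
  have shift_pow (n : ℕ) (d : D) : ((s 0 * s (-1)) ^ n) d = e (d, n) := by
    induction n with
    | zero => exact (he d).symm
    | succ n ih => rw [pow_succ', Perm.mul_apply, ih, shift, Nat.cast_succ]
  refine ⟨s 0, s (-1), hs 0, hs (-1), fun n n' hn => Set.disjoint_left.2 ?_⟩
  rintro _ ⟨d, hd, rfl⟩ ⟨d', hd', h⟩
  rw [shift_pow n ⟨d, hd⟩, shift_pow n' ⟨d', hd'⟩] at h
  exact hn (Nat.cast_injective (congrArg Prod.snd (e.injective h)).symm)

end CardinalInvolutions

section FreeAlgebra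

open FirstOrder.Language Function

variable {L : FirstOrder.Language.{u, v}}

/-- The isomorphism given by two mutually inverse homomorphisms. -/
def equivOfInverseHoms {M N : Type*} [L.Structure M] [L.Structure N] (f : M →[L] N)
    (g : N →[L] M) (hgf : g.comp f = Hom.id L M) (hfg : f.comp g = Hom.id L N) : M ≃[L] N where
  toFun := f
  invFun := g
  left_inv := DFunLike.congr_fun hgf
  right_inv := DFunLike.congr_fun hfg
  map_fun' := f.map_fun
  map_rel' r x := by
    refine ⟨fun h => ?_, f.map_rel r x⟩
    have hx : g ∘ f ∘ x = x := funext fun i => DFunLike.congr_fun hgf (x i)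
    exact hx ▸ g.map_rel r (f ∘ x) h

theorem equiv_apply_mem_closure_image {M N : Type*} [L.Structure M] [L.Structure N]
    (f : M ≃[L] N) {X : Set M} {x : M} :
    f x ∈ Substructure.closure L (f '' X) ↔ x ∈ Substructure.closure L X := by
  rw [show f '' X = f.toHom '' X from rfl, Substructure.closure_image]
  exact ⟨fun ⟨y, hy, hyx⟩ => f.injective hyx ▸ hy, fun hx => ⟨x, hx, rfl⟩⟩

theorem exists_finite_mem_closure {M : Type*} [L.Structure M] {X : Set M} {x : M}
    (hx : x ∈ Substructure.closure L X) :
    ∃ s ⊆ X, s.Finite ∧ x ∈ Substructure.closure L s := by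
  refine Substructure.closure_induction
    (p := fun x => ∃ s ⊆ X, s.Finite ∧ x ∈ Substructure.closure L s) hx (fun x hx => ?_) ?_
  · exact ⟨{x}, Set.singleton_subset_iff.2 hx, Set.finite_singleton x,
      Substructure.subset_closure rfl⟩
  · intro n f xs hxs
    choose s hsX hsf hs using hxs
    refine ⟨⋃ i, s i, Set.iUnion_subset hsX, Set.finite_iUnion hsf, ?_⟩
    exact Substructure.fun_mem _ f xs fun i =>
      Substructure.closure_mono (Set.subset_iUnion s i) (hs i)

variable {E : Set (L.Term ℕ × L.Term ℕ)}

theorem InVariety.of_injective {A A' : Type*} [L.Structure A] [L.Structure A']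
    (h : InVariety E A') (g : A →[L] A') (hg : Injective g) : InVariety E A := by
  intro p hp x
  apply hg
  rw [← HomClass.realize_term g, ← HomClass.realize_term g]
  exact h p hp _

variable {F : Type w} [L.Structure F] {B : Set F}

theorem IsFreeBasis.existsUnique_hom_same_universe (hB : IsFreeBasis E B) {A : Type w}
    [L.Structure A] (hA : InVariety E A) (f : B → A) : ∃! φ : F →[L] A, ∀ b : B, φ b = f b := by
  let _ : L.Structure (ULift.{u} A) := Equiv.ulift.{u}.symm.inducedStructure
  let e : A ≃[L] ULift.{u} A := Equiv.ulift.{u}.symm.inducedStructureEquiv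
  have hU : InVariety E (ULift.{u} A) := hA.of_injective e.symm.toHom e.symm.injective
  obtain ⟨φ, hφ, huniq⟩ := hB.existsUnique_hom (ULift.{u} A) hU fun b => e (f b)
  refine ⟨e.symm.toHom.comp φ, fun b => ?_, fun ψ hψ => ?_⟩
  · exact (congrArg e.symm (hφ b)).trans (e.symm_apply_apply (f b))
  · rw [← huniq (e.toHom.comp ψ) fun b => congrArg e (hψ b)]
    ext x
    exact (e.symm_apply_apply (ψ x)).symm

/-- The extension of a map from a basis to a homomorphism. -/
noncomputable def IsFreeBasis.lift (hB : IsFreeBasis E B) {A : Type w} [L.Structure A]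
    (hA : InVariety E A) (f : B → A) : F →[L] A :=
  (hB.existsUnique_hom_same_universe hA f).choose

theorem IsFreeBasis.lift_apply (hB : IsFreeBasis E B) {A : Type w} [L.Structure A]
    (hA : InVariety E A) (f : B → A) (b : B) : hB.lift hA f b = f b :=
  (hB.existsUnique_hom_same_universe hA f).choose_spec.1 b

theorem IsFreeBasis.hom_ext (hB : IsFreeBasis E B) {A : Type w} [L.Structure A]
    (hA : InVariety E A) {φ ψ : F →[L] A} (h : ∀ b : B, φ b = ψ b) : φ = ψ :=
  (hB.existsUnique_hom_same_universe hA fun b => ψ b).unique h fun _ => rfl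

theorem IsFreeBasis.aut_ext (hB : IsFreeBasis E B) {φ ψ : F ≃[L] F}
    (h : ∀ b : B, φ b = ψ b) : φ = ψ :=
  Language.Equiv.ext fun x =>
    DFunLike.congr_fun (hB.hom_ext hB.inVariety (φ := φ.toHom) (ψ := ψ.toHom) h) x

theorem IsFreeBasis.closure_eq_top (hB : IsFreeBasis E B) :
    Substructure.closure L B = ⊤ := by
  let S := Substructure.closure L B
  have hS : InVariety E S := hB.inVariety.of_injective S.subtype.toHom S.subtype.injective
  let φ : F →[L] S := hB.lift hS fun b => ⟨b, Substructure.subset_closure b.2⟩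
  have h : S.subtype.toHom.comp φ = Hom.id L F := hB.hom_ext hB.inVariety fun b =>
    congrArg Subtype.val (hB.lift_apply hS _ b)
  refine eq_top_iff.2 fun x _ => ?_
  have hx : (φ x : F) = x := DFunLike.congr_fun h x
  exact hx ▸ (φ x).2

/-- The automorphism of a free algebra induced by a permutation of its basis. -/
noncomputable def IsFreeBasis.permAut (hB : IsFreeBasis E B) :
    Equiv.Perm B →* (F ≃[L] F) :=
  let ext (p : Equiv.Perm B) : F →[L] F := hB.lift hB.inVariety fun b => p b
  have ext_apply (p : Equiv.Perm B) (b : B) : ext p b = p b := hB.lift_apply hB.inVariety _ b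
  have ext_comp (p q : Equiv.Perm B) : (ext p).comp (ext q) = ext (p * q) :=
    hB.hom_ext hB.inVariety fun b => by
      rw [Hom.comp_apply, ext_apply, ext_apply, ext_apply, Equiv.Perm.mul_apply]
  have ext_one : ext 1 = Hom.id L F := hB.hom_ext hB.inVariety (ext_apply 1)
  MonoidHom.mk'
    (fun p => equivOfInverseHoms (ext p) (ext p⁻¹) (by rw [ext_comp, inv_mul_cancel, ext_one])
      (by rw [ext_comp, mul_inv_cancel, ext_one]))
    fun p q => hB.aut_ext fun b => DFunLike.congr_fun (ext_comp p q).symm (b : F)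

theorem IsFreeBasis.permAut_apply (hB : IsFreeBasis E B) (p : Equiv.Perm B) (b : B) :
    hB.permAut p b = p b :=
  hB.lift_apply hB.inVariety _ b

theorem IsFreeBasis.permAut_image (hB : IsFreeBasis E B) (p : Equiv.Perm B) (D : Set B) :
    hB.permAut p '' (Subtype.val '' D) = Subtype.val '' (p '' D) := by
  rw [Set.image_image, Set.image_image]
  exact Set.image_congr fun b _ => hB.permAut_apply p b

theorem IsFreeBasis.autSupport_permAut (hB : IsFreeBasis E B) (p : Equiv.Perm B) :
    autSupport B (hB.permAut p) = Subtype.val '' {b | p b ≠ b} := by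
  ext x
  refine ⟨fun ⟨hx, hne⟩ => ⟨⟨x, hx⟩, fun h => hne ?_, rfl⟩, ?_⟩
  · exact (hB.permAut_apply p ⟨x, hx⟩).trans (congrArg Subtype.val h)
  · rintro ⟨b, hb, rfl⟩
    exact ⟨b.2, fun h => hb (Subtype.ext ((hB.permAut_apply p b).symm.trans h))⟩

theorem IsFreeBasis.permAut_mem_boundedAut (hB : IsFreeBasis E B) {p : Equiv.Perm B}
    {lam : Cardinal.{w}} (hlam : ℵ₀ ≤ lam) :
    hB.permAut p ∈ boundedAut L B lam hlam ↔ #{b | p b ≠ b} ≤ lam := by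
  rw [← mk_image_eq (s := {b | p b ≠ b}) Subtype.val_injective, ← hB.autSupport_permAut]
  rfl

/-- The automorphisms that fix `B \ D` pointwise and restrict to automorphisms of the subalgebra
generated by `D`. Stating the invariance of the subalgebra as an equivalence makes it pass to
inverses. -/
def supportedAut (L : FirstOrder.Language.{u, v}) {F : Type w} [L.Structure F] {B : Set F}
    (D : Set B) : Subgroup (F ≃[L] F) where
  carrier := {φ | (∀ b ∉ D, φ b = b) ∧ ∀ x,
    φ x ∈ Substructure.closure L (Subtype.val '' D) ↔ x ∈ Substructure.closure L (Subtype.val '' D)}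
  one_mem' := ⟨fun _ _ => rfl, fun _ => Iff.rfl⟩
  mul_mem' {φ ψ} hφ hψ :=
    ⟨fun b hb => (congrArg φ (hψ.1 b hb)).trans (hφ.1 b hb),
      fun x => (hφ.2 (ψ x)).trans (hψ.2 x)⟩
  inv_mem' {φ} hφ :=
    ⟨fun b hb => (congrArg ⇑φ⁻¹ (hφ.1 b hb).symm).trans (aut_inv_apply_self φ b),
      fun x => (hφ.2 (φ⁻¹ x)).symm.trans (by rw [← aut_mul_apply, mul_inv_cancel, aut_one_apply])⟩

theorem mem_supportedAut_of_subset {φ : F ≃[L] F} {D : Set B}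
    (hsupp : Subtype.val ⁻¹' autSupport B φ ⊆ D)
    (hφ : φ '' autSupport B φ ⊆ Substructure.closure L (Subtype.val '' D))
    (hφ_inv : ⇑φ⁻¹ '' autSupport B φ ⊆ Substructure.closure L (Subtype.val '' D)) :
    φ ∈ supportedAut L D := by
  have fixed (b : B) (hb : (b : F) ∉ autSupport B φ) : φ b = b := by
    by_contra h
    exact hb ⟨b.2, h⟩
  have preserves (ψ : F ≃[L] F)
      (hψ : ψ '' autSupport B φ ⊆ Substructure.closure L (Subtype.val '' D))
      (hψ_fixed : ∀ b : B, (b : F) ∉ autSupport B φ → ψ b = b) {x : F}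
      (hx : x ∈ Substructure.closure L (Subtype.val '' D)) :
      ψ x ∈ Substructure.closure L (Subtype.val '' D) := by
    suffices h : ψ '' (Subtype.val '' D) ⊆ Substructure.closure L (Subtype.val '' D) from
      Substructure.closure_le.2 h ((equiv_apply_mem_closure_image ψ).2 hx)
    rintro _ ⟨_, ⟨b, hb, rfl⟩, rfl⟩
    by_cases hbφ : (b : F) ∈ autSupport B φ
    · exact hψ ⟨b, hbφ, rfl⟩
    · rw [hψ_fixed b hbφ]
      exact Substructure.subset_closure ⟨b, hb, rfl⟩
  have fixed_inv (b : B) (hb : (b : F) ∉ autSupport B φ) : φ⁻¹ b = b :=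
    (congrArg ⇑φ⁻¹ (fixed b hb).symm).trans (aut_inv_apply_self φ b)
  refine ⟨fun b hb => fixed b fun h => hb (hsupp h), fun x => ⟨fun hx => ?_, preserves φ hφ fixed⟩⟩
  exact aut_inv_apply_self φ x ▸ preserves φ⁻¹ hφ_inv fixed_inv hx

theorem apply_eq_self_of_mem_supportedAut {φ : F ≃[L] F} {C D : Set B} (hφ : φ ∈ supportedAut L D)
    (hdisj : Disjoint C D) {x : F} (hx : x ∈ Substructure.closure L (Subtype.val '' C)) :
    φ x = x := by
  refine Hom.eqOn_closure (f := φ.toHom) (g := Hom.id L F) ?_ hx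
  rintro _ ⟨b, hb, rfl⟩
  exact hφ.1 b (Set.disjoint_left.1 hdisj hb)

theorem IsFreeBasis.permAut_apply_mem_closure (hB : IsFreeBasis E B) (q : Equiv.Perm B) {D : Set B}
    {x : F} : hB.permAut q x ∈ Substructure.closure L (Subtype.val '' (q '' D)) ↔
      x ∈ Substructure.closure L (Subtype.val '' D) := by
  rw [← hB.permAut_image, equiv_apply_mem_closure_image]

theorem IsFreeBasis.conj_permAut_mem_supportedAut (hB : IsFreeBasis E B) (q : Equiv.Perm B)
    {φ : F ≃[L] F} {D : Set B} (hφ : φ ∈ supportedAut L D) :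
    hB.permAut q * φ * (hB.permAut q)⁻¹ ∈ supportedAut L (q '' D) := by
  constructor
  · intro b hb
    have hqb : q⁻¹ b ∉ D := fun h => hb ⟨_, h, q.apply_symm_apply b⟩
    rw [← map_inv, aut_mul_apply, aut_mul_apply, permAut_apply, hφ.1 _ hqb, permAut_apply,
      ← Equiv.Perm.mul_apply, mul_inv_cancel, Equiv.Perm.one_apply]
  · intro x
    rw [aut_mul_apply, aut_mul_apply, hB.permAut_apply_mem_closure, hφ.2,
      ← hB.permAut_apply_mem_closure q, ← aut_mul_apply, mul_inv_cancel, aut_one_apply]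

theorem IsFreeBasis.exists_subset_closure_image (hB : IsFreeBasis E B) {lam : Cardinal.{w}}
    (hlam : ℵ₀ ≤ lam) {X : Set F} (hX : #X ≤ lam) :
    ∃ D : Set B, #D ≤ lam ∧ X ⊆ Substructure.closure L (Subtype.val '' D) := by
  have mem_closure (x : F) : x ∈ Substructure.closure L B :=
    hB.closure_eq_top ▸ Substructure.mem_top x
  choose s hsB hsf hs using fun x => exists_finite_mem_closure (mem_closure x)
  refine ⟨⋃ x : X, Subtype.val ⁻¹' s x, ?_, fun x hx => ?_⟩
  · refine (mk_iUnion_le _).trans (mul_le_of_le hlam hX (ciSup_le' fun x => ?_))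
    exact ((hsf x).preimage Subtype.val_injective.injOn).lt_aleph0.le.trans hlam
  · refine Substructure.closure_mono (fun b hb => ?_) (hs x)
    exact ⟨⟨b, hsB x hb⟩, Set.mem_iUnion.2 ⟨⟨x, hx⟩, hb⟩, rfl⟩

theorem IsFreeBasis.exists_mem_supportedAut (hB : IsFreeBasis E B) {lam : Cardinal.{w}}
    (hlam : ℵ₀ ≤ lam) (hle : lam ≤ #B) {φ : F ≃[L] F} (hφ : φ ∈ boundedAut L B lam hlam) :
    ∃ D : Set B, #D = lam ∧ φ ∈ supportedAut L D := by
  have union_le {α : Type w} {X Y : Set α} (hX : #X ≤ lam) (hY : #Y ≤ lam) :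
      #(X ∪ Y : Set α) ≤ lam := (mk_union_le X Y).trans (add_le_of_le hlam hX hY)
  have hφ' : #(autSupport B φ) ≤ lam := hφ
  obtain ⟨P, hP⟩ := le_mk_iff_exists_set.1 hle
  obtain ⟨D, hD, himage⟩ := hB.exists_subset_closure_image hlam
    (union_le (mk_image_le.trans hφ' : #(φ '' autSupport B φ) ≤ lam)
      (mk_image_le.trans hφ' : #(⇑φ⁻¹ '' autSupport B φ) ≤ lam))
  let T : Set B := Subtype.val ⁻¹' autSupport B φ
  have hT : #T ≤ lam := (mk_preimage_of_injective _ _ Subtype.val_injective).trans hφ'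
  have hmono : (Substructure.closure L (Subtype.val '' D) : Set F) ⊆
      Substructure.closure L (Subtype.val '' (P ∪ T ∪ D)) :=
    Substructure.closure_mono (Set.image_mono Set.subset_union_right)
  refine ⟨P ∪ T ∪ D, le_antisymm (union_le (union_le hP.le hT) hD) ?_, ?_⟩
  · exact hP.symm.le.trans (mk_le_mk_of_subset
      (Set.subset_union_left.trans Set.subset_union_left))
  · exact mem_supportedAut_of_subset (Set.subset_union_right.trans Set.subset_union_left)
      (Set.subset_union_left.trans (himage.trans hmono))
      (Set.subset_union_right.trans (himage.trans hmono))

theorem IsFreeBasis.exists_hom_eqOn (hB : IsFreeBasis E B) {A : Type w} [L.Structure A]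
    (hA : InVariety E A) {ι : Type*} {D : ι → Set B} (hD : Pairwise (Disjoint on D))
    (ψ : ι → F →[L] A) (χ : F →[L] A) :
    ∃ θ : F →[L] A, (∀ i, Set.EqOn θ (ψ i) (Substructure.closure L (Subtype.val '' D i))) ∧
      ∀ b ∉ ⋃ i, D i, θ b = χ b := by
  classical
  let f (b : B) : A := if h : ∃ i, b ∈ D i then ψ h.choose b else χ b
  refine ⟨hB.lift hA f, fun i => Hom.eqOn_closure ?_, fun b hb => ?_⟩
  · rintro _ ⟨b, hb, rfl⟩
    have h : ∃ i, b ∈ D i := ⟨i, hb⟩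
    have hi : h.choose = i := hD.eq (Set.not_disjoint_iff.2 ⟨b, h.choose_spec, hb⟩)
    rw [hB.lift_apply]
    exact (dif_pos h).trans (by rw [hi])
  · rw [hB.lift_apply]
    exact dif_neg fun h => hb (Set.mem_iUnion.2 h)

theorem IsFreeBasis.exists_aut_eqOn (hB : IsFreeBasis E B) {ι : Type*} {D : ι → Set B}
    (hD : Pairwise (Disjoint on D)) {ψ : ι → F ≃[L] F} (hψ : ∀ i, ψ i ∈ supportedAut L (D i)) :
    ∃ α : F ≃[L] F, (∀ i, ∀ b ∈ D i, α b = ψ i b) ∧ ∀ b ∉ ⋃ i, D i, α b = b := by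
  choose θ hθ hθ_fixed using fun ψ : ι → F ≃[L] F =>
    hB.exists_hom_eqOn hB.inVariety hD (fun i => (ψ i).toHom) (Hom.id L F)
  have mem_closure {i : ι} {b : B} (hb : b ∈ D i) :
      (b : F) ∈ Substructure.closure L (Subtype.val '' D i) :=
    Substructure.subset_closure ⟨b, hb, rfl⟩
  have inv_comp (ψ : ι → F ≃[L] F) (hψ : ∀ i, ψ i ∈ supportedAut L (D i)) :
      (θ ψ⁻¹).comp (θ ψ) = Hom.id L F := hB.hom_ext hB.inVariety fun b => by
    rw [Hom.comp_apply, Hom.id_apply]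
    by_cases hb : b ∈ ⋃ i, D i
    · obtain ⟨i, hi⟩ := Set.mem_iUnion.1 hb
      rw [hθ ψ i (mem_closure hi)]
      exact (hθ ψ⁻¹ i (((hψ i).2 b).2 (mem_closure hi))).trans (aut_inv_apply_self (ψ i) b)
    · exact (congrArg (θ ψ⁻¹) (hθ_fixed ψ b hb)).trans (hθ_fixed ψ⁻¹ b hb)
  have comp_inv : (θ ψ).comp (θ ψ⁻¹) = Hom.id L F := by
    simpa only [inv_inv] using inv_comp ψ⁻¹ fun i => inv_mem (hψ i)
  exact ⟨equivOfInverseHoms (θ ψ) (θ ψ⁻¹) (inv_comp ψ hψ) comp_inv,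
    fun i b hb => hθ ψ i (mem_closure hb), hθ_fixed ψ⟩

theorem IsFreeBasis.exists_eq_commutatorElement (hB : IsFreeBasis E B) {p : Equiv.Perm B}
    {D : Set B} (hp : Pairwise (Disjoint on fun n : ℕ => ⇑(p ^ n) '' D)) {φ : F ≃[L] F}
    (hφ : φ ∈ supportedAut L D) :
    ∃ α : F ≃[L] F, (∀ b ∉ ⋃ n : ℕ, ⇑(p ^ n) '' D, α b = b) ∧ φ = ⁅α, hB.permAut p⁆ := by
  obtain ⟨α, hα, hα_fixed⟩ := hB.exists_aut_eqOn hp fun n =>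
    hB.conj_permAut_mem_supportedAut (p ^ n) hφ
  have α_pow (n : ℕ) (d : B) (hd : d ∈ D) :
      α ((p ^ n) d : B) = hB.permAut (p ^ n) (φ d) := by
    rw [hα n _ ⟨d, hd, rfl⟩, ← hB.permAut_apply, aut_mul_apply, aut_mul_apply, aut_inv_apply_self]
  have α_eq (d : B) (hd : d ∈ D) : α d = φ d := by
    simpa only [pow_zero, Equiv.Perm.one_apply, map_one, aut_one_apply] using α_pow 0 d hd
  suffices key : α * hB.permAut p = φ * (hB.permAut p * α) by
    refine ⟨α, hα_fixed, ?_⟩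
    rw [commutatorElement_def, key]
    group
  refine hB.aut_ext fun b => ?_
  rw [aut_mul_apply, aut_mul_apply, aut_mul_apply, hB.permAut_apply]
  by_cases hb : b ∈ ⋃ n : ℕ, ⇑(p ^ n) '' D
  · obtain ⟨n, d, hd, rfl⟩ := Set.mem_iUnion.1 hb
    have hdisj : Disjoint (⇑(p ^ (n + 1)) '' D) D := by
      simpa only [onFun, pow_zero, Equiv.Perm.coe_one, Set.image_id] using hp (Nat.succ_ne_zero n)
    have hmem := (hB.permAut_apply_mem_closure (p ^ (n + 1))).2
      ((hφ.2 d).2 (Substructure.subset_closure ⟨d, hd, rfl⟩))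
    rw [← Equiv.Perm.mul_apply, ← pow_succ', α_pow _ d hd, α_pow _ d hd,
      ← aut_mul_apply (hB.permAut p), ← map_mul, ← pow_succ',
      apply_eq_self_of_mem_supportedAut hφ hdisj hmem]
  · rw [hα_fixed b hb, hB.permAut_apply]
    by_cases hpb : p b ∈ D
    · exact α_eq _ hpb
    · rw [hφ.1 _ hpb]
      refine hα_fixed _ fun h => ?_
      obtain ⟨_ | n, d, hd, hdb⟩ := Set.mem_iUnion.1 h
      · exact hpb (hdb ▸ hd)
      · rw [pow_succ', Equiv.Perm.mul_apply] at hdb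
        exact hb (Set.mem_iUnion.2 ⟨n, d, hd, p.injective hdb⟩)

theorem IsFreeBasis.exists_eq_commutatorElement_involutive (hB : IsFreeBasis E B)
    {lam : Cardinal.{w}} (hlam : ℵ₀ ≤ lam) (hlt : lam < #B) {φ : F ≃[L] F}
    (hφ : φ ∈ boundedAut L B lam hlam) :
    ∃ α ∈ boundedAut L B lam hlam, ∃ ρ τ : Equiv.Perm B,
      (Involutive ρ ∧ #{b | ρ b ≠ b} = lam) ∧ (Involutive τ ∧ #{b | τ b ≠ b} = lam) ∧
      φ = ⁅α, hB.permAut ρ * hB.permAut τ⁆ := by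
  obtain ⟨D, rfl, hD⟩ := hB.exists_mem_supportedAut hlam hlt.le hφ
  have : Infinite D := infinite_iff.2 hlam
  obtain ⟨ρ, τ, hρ, hτ, hdisj⟩ := exists_involutive_pairwise_disjoint_pow_image D hlt
  obtain ⟨α, hα, rfl⟩ := hB.exists_eq_commutatorElement hdisj hD
  refine ⟨α, ?_, ρ, τ, hρ, hτ, by rw [map_mul]⟩
  have hsupp : autSupport B α ⊆ Subtype.val '' ⋃ n : ℕ, ⇑((ρ * τ) ^ n) '' D := by
    rintro b ⟨hb, hne⟩
    by_contra h
    exact hne (hα ⟨b, hb⟩ fun h' => h ⟨_, h', rfl⟩)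
  calc #(autSupport B α) ≤ #(⋃ n : ℕ, ⇑((ρ * τ) ^ n) '' D : Set B) :=
        (mk_le_mk_of_subset hsupp).trans mk_image_le
    _ ≤ #D := by
        have h := mk_iUnion_le_lift fun n : ℕ => ⇑((ρ * τ) ^ n) '' D
        rw [lift_uzero, mk_nat, lift_aleph0] at h
        refine h.trans (mul_le_of_le hlam hlam (ciSup_le' fun n => ?_))
        exact (lift_uzero _).trans_le mk_image_le

end FreeAlgebra

section FreeInvolutions

open FirstOrder.Language Function

variable {L : FirstOrder.Language.{u, v}} {E : Set (L.Term ℕ × L.Term ℕ)}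
  {F : Type w} [L.Structure F] {B : Set F}

theorem IsFreeBasis.isPermutational_permAut (hB : IsFreeBasis E B) (p : Equiv.Perm B) :
    IsPermutational E (hB.permAut p) := by
  have h := hB.permAut_image p Set.univ
  rw [Set.image_univ_of_surjective p.surjective, Set.image_univ, Subtype.range_coe] at h
  exact ⟨B, hB, h⟩

theorem IsFreeBasis.permAut_injective (hB : IsFreeBasis E B) : Injective hB.permAut :=
  fun p q h => Equiv.ext fun b => Subtype.ext <| by
    rw [← hB.permAut_apply, h, hB.permAut_apply]

theorem IsFreeBasis.orderOf_permAut_eq_two (hB : IsFreeBasis E B) {r : Equiv.Perm B}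
    (hr : Involutive r) (hne : {b | r b ≠ b}.Nonempty) : orderOf (hB.permAut r) = 2 := by
  rw [orderOf_injective hB.permAut hB.permAut_injective]
  refine orderOf_eq_prime (Equiv.ext fun b => by rw [pow_two]; exact hr b) ?_
  rintro rfl
  obtain ⟨b, hb⟩ := hne
  exact hb rfl

theorem IsFreeBasis.isFreeInvolutionOn_permAut (hB : IsFreeBasis E B) {r : Equiv.Perm B}
    (hr : Involutive r) :
    IsFreeInvolutionOn B (Subtype.val '' {b | r b ≠ b}) (hB.permAut r) := by
  rw [← hB.autSupport_permAut]
  refine ⟨fun b ⟨hb, hfix⟩ => not_not.1 fun h => hfix ⟨hb, h⟩, fun c ⟨hc, hne⟩ => ?_⟩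
  have hrr : hB.permAut r (hB.permAut r c) = c := by
    rw [hB.permAut_apply r ⟨c, hc⟩, hB.permAut_apply, hr]
  refine ⟨⟨?_, fun h => hne ((hB.permAut r).injective h)⟩, hne, hrr⟩
  exact (hB.permAut_apply r ⟨c, hc⟩).symm ▸ (r ⟨c, hc⟩).2

theorem IsFreeInvolutionOn.exists_permAut_eq {C : Set F} {π : F ≃[L] F}
    (hπ : IsFreeInvolutionOn B C π) (hB : IsFreeBasis E B) (hC : C ⊆ B) :
    ∃ r : Equiv.Perm B, Involutive r ∧ Subtype.val '' {b | r b ≠ b} = C ∧ hB.permAut r = π := by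
  have apply_mem_and_apply_apply (b : B) : π b ∈ B ∧ π (π b) = b := by
    by_cases h : (b : F) ∈ C
    · exact ⟨hC (hπ.2 b h).1, (hπ.2 b h).2.2⟩
    · rw [hπ.1 b ⟨b.2, h⟩, hπ.1 b ⟨b.2, h⟩]
      exact ⟨b.2, rfl⟩
  let f (b : B) : B := ⟨π b, (apply_mem_and_apply_apply b).1⟩
  have hf : Involutive f := fun b => Subtype.ext (apply_mem_and_apply_apply b).2
  have hperm : hB.permAut (hf.toPerm f) = π := hB.aut_ext (hB.permAut_apply (hf.toPerm f))
  refine ⟨hf.toPerm f, hf, ?_, hperm⟩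
  rw [← hB.autSupport_permAut, hperm]
  refine Set.Subset.antisymm (fun b ⟨hb, hne⟩ => ?_) fun c hc => ⟨hC hc, (hπ.2 c hc).2.1⟩
  by_contra h
  exact hne (hπ.1 b ⟨hb, h⟩)

theorem IsFreeBasis.exists_isFreeInvolutionOn (hB : IsFreeBasis E B) {lam : Cardinal.{w}}
    (hlam : ℵ₀ ≤ lam) (hlt : lam < #B) :
    ∃ C ⊆ B, #C = lam ∧ ∃ π : boundedAut L B lam hlam,
      IsFreeInvolutionOn B C (π : F ≃[L] F) := by
  obtain ⟨D, rfl⟩ := le_mk_iff_exists_set.1 hlt.le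
  have : Infinite D := infinite_iff.2 hlam
  obtain ⟨r, -, ⟨hr, hcard⟩, -⟩ := exists_involutive_pairwise_disjoint_pow_image D hlt
  exact ⟨Subtype.val '' {b | r b ≠ b}, Subtype.coe_image_subset B _,
    (mk_image_eq Subtype.val_injective).trans hcard,
    ⟨hB.permAut r, (hB.permAut_mem_boundedAut hlam).2 hcard.le⟩, hB.isFreeInvolutionOn_permAut hr⟩

theorem IsFreeBasis.isConj_of_permAut_eq (hB : IsFreeBasis E B) {lam : Cardinal.{w}}
    {hlam : ℵ₀ ≤ lam} (hlt : lam < #B) {r p : Equiv.Perm B}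
    (hr : Involutive r ∧ #{b | r b ≠ b} = lam) (hp : Involutive p ∧ #{b | p b ≠ b} = lam)
    {π ρ : boundedAut L B lam hlam} (hπ : hB.permAut r = π) (hρ : hB.permAut p = ρ) :
    IsConj π ρ := by
  obtain ⟨hr, rfl⟩ := hr
  obtain ⟨c, hc, hconj⟩ := exists_conj_eq_of_involutive hr hp.1 hlam hlt hp.2
  refine isConj_iff.2 ⟨⟨hB.permAut c, (hB.permAut_mem_boundedAut hlam).2 hc⟩, Subtype.ext ?_⟩
  rw [Subgroup.coe_mul, Subgroup.coe_mul, Subgroup.coe_inv, ← hπ, ← hρ, ← hconj, map_mul, map_mul,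
    map_inv]

theorem IsFreeBasis.conjugatesOf_pow_four_eq_univ (hB : IsFreeBasis E B) {lam : Cardinal.{w}}
    {hlam : ℵ₀ ≤ lam} (hlt : lam < #B) {r : Equiv.Perm B}
    (hr : Involutive r ∧ #{b | r b ≠ b} = lam) {π : boundedAut L B lam hlam}
    (hπ : hB.permAut r = π) : conjugatesOf π ^ 4 = Set.univ := by
  have hπ_inv : π⁻¹ = π := by
    have hrr : r⁻¹ = r := Equiv.ext fun b => r.injective (by simp [hr.1 b])
    rw [← SetLike.coe_eq_coe, Subgroup.coe_inv, ← hπ, ← map_inv, hrr]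
  refine Set.eq_univ_of_forall fun φ => ?_
  obtain ⟨α, hα, ρ, τ, hρ, hτ, hφ⟩ := hB.exists_eq_commutatorElement_involutive hlam hlt φ.2
  let ρ' : boundedAut L B lam hlam := ⟨_, (hB.permAut_mem_boundedAut hlam).2 hρ.2.le⟩
  let τ' : boundedAut L B lam hlam := ⟨_, (hB.permAut_mem_boundedAut hlam).2 hτ.2.le⟩
  let α' : boundedAut L B lam hlam := ⟨α, hα⟩
  have hφ' : φ = ⁅α', ρ' * τ'⁆ := Subtype.ext hφ
  exact hφ' ▸ commutatorElement_mul_mem_conjugatesOf_pow_four hπ_inv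
    (hB.isConj_of_permAut_eq hlt hr hρ hπ rfl) (hB.isConj_of_permAut_eq hlt hr hτ hπ rfl) α'

end FreeInvolutions

theorem mainTheorem2_general {L : FirstOrder.Language.{u, v}} (E : Set (L.Term ℕ × L.Term ℕ))
    {F : Type w} [L.Structure F] (B : Set F) (hB : IsFreeBasis E B)
    (lam : Cardinal.{w}) (hlam : ℵ₀ ≤ lam) (hlt : lam < #B) :
    (∃ C ⊆ B, #C = lam ∧ ∃ π : boundedAut L B lam hlam,
      IsFreeInvolutionOn B C (π : F ≃[L] F)) ∧
    (∀ C ⊆ B, #C = lam → ∀ π : boundedAut L B lam hlam,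
      IsFreeInvolutionOn B C (π : F ≃[L] F) →
        IsPermutational E (π : F ≃[L] F) ∧ orderOf π = 2 ∧
        Subgroup.closure (conjugatesOf π) = ⊤ ∧
        conjugatesOf π ^ 4 = Set.univ ∧
        groupWidth (conjugatesOf π) ≤ 4) ∧
    FiniteCWidth (boundedAut L B lam hlam) := by
  have hinvol {C : Set F} (hC : C ⊆ B) (hcard : #C = lam) {π : boundedAut L B lam hlam}
      (hπ : IsFreeInvolutionOn B C (π : F ≃[L] F)) :
      ∃ r : Equiv.Perm B, (Function.Involutive r ∧ #{b | r b ≠ b} = lam) ∧ hB.permAut r = π := by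
    obtain ⟨r, hr, rfl, hrπ⟩ := hπ.exists_permAut_eq hB hC
    exact ⟨r, ⟨hr, (mk_image_eq Subtype.val_injective).symm.trans hcard⟩, hrπ⟩
  have hexists := hB.exists_isFreeInvolutionOn hlam hlt
  refine ⟨hexists, fun C hC hcard π hπ => ?_, ?_⟩
  · obtain ⟨r, hr, hrπ⟩ := hinvol hC hcard hπ
    have hpow := hB.conjugatesOf_pow_four_eq_univ hlt hr hrπ
    have hmoved : {b | r b ≠ b}.Nonempty :=
      Set.nonempty_coe_sort.1 (mk_ne_zero_iff.1 (hr.2 ▸ (aleph0_pos.trans_le hlam).ne'))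
    refine ⟨hrπ ▸ hB.isPermutational_permAut r, ?_, closure_eq_top_of_pow_eq_univ hpow, hpow,
      groupWidth_le_of_pow_eq_univ hpow⟩
    rw [← Subgroup.orderOf_coe, ← hrπ, hB.orderOf_permAut_eq_two hr.1 hmoved]
  · obtain ⟨C, hC, hcard, π, hπ⟩ := hexists
    obtain ⟨r, hr, hrπ⟩ := hinvol hC hcard hπ
    exact finiteCWidth_of_conjugatesOf_pow_eq_univ (hB.conjugatesOf_pow_four_eq_univ hlt hr hrπ)

theorem mainTheorem2 {L : FirstOrder.Language.{u, v}} [L.IsAlgebraic] (E : Set (L.Term ℕ × L.Term ℕ))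
    {F : Type w} [L.Structure F] (B : Set F) (hB : IsFreeBasis E B)
    (κ lam : Cardinal.{w}) (hκ : #B = κ) (hlam : ℵ₀ ≤ lam) (hlt : lam < κ) :
    (∃ C ⊆ B, #C = lam ∧ ∃ π : boundedAut L B lam hlam,
      IsFreeInvolutionOn B C (π : F ≃[L] F)) ∧
    (∀ C ⊆ B, #C = lam → ∀ π : boundedAut L B lam hlam,
      IsFreeInvolutionOn B C (π : F ≃[L] F) →
        IsPermutational E (π : F ≃[L] F) ∧ orderOf π = 2 ∧
        Subgroup.closure (conjugatesOf π) = ⊤ ∧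
        conjugatesOf π ^ 4 = Set.univ ∧
        groupWidth (conjugatesOf π) ≤ 4) ∧
    FiniteCWidth (boundedAut L B lam hlam) := by
  subst hκ
  exact mainTheorem2_general E B hB lam hlam hlt
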